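/- For a Hermitian matrix $A\in M_n(\mathbb C)$ let $\lambda_1(A)\ge\dots\ge\lambda_n(A)$ be its eigenvalues counted with multiplicity, let $\mathrm{Spr}(A)=(\lambda_i(A)-\lambda_{n-i+1}(A))_{i=1}^n\in\mathbb R^n$ be its full spectral spread, and let $s(A)\in\mathbb R^n$ be the vector of its singular values. For $x,y\in\mathbb R^n$ write $x\prec_w y$ if $\sum_{i=1}^j x_i^\downarrow\le\sum_{i=1}^j y_i^\downarrow$ for $j=1,\dots,n$, where $x^\downarrow$ is the non-increasing rearrangement of $x$; moduli and scalar multiples of vectors are taken entrywise. Let $\mathcal S,\mathcal T\subseteq\mathbb C^n$ be $k$-dimensional subspaces. A unitary matrix $U\in M_n(\mathbb C)$ is called a direct rotation from $\mathcal S$ onto $\mathcal T$ if $U\mathcal S=\mathcal T$ and there are a unitary matrix $W\in M_n(\mathbb C)$ whose first $k$ columns form an orthonormal basis of $\mathcal S$, positive semidefinite matrices $C_0\in M_k(\mathbb C)$ and $C_1\in M_{n-k}(\mathbb C)$, and $S_0\in M_{n-k,k}(\mathbb C)$ such that $$W^*UW=\begin{bmatrix}C_0&-S_0^*\\ S_0&C_1\end{bmatrix}.$$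 Let $X\in M_n(\mathbb C)$ be Hermitian with $e^{iX}\mathcal S=\mathcal T$. If $U=e^{iZ}$ is a direct rotation from $\mathcal S$ onto $\mathcal T$, where $Z\in M_n(\mathbb C)$ is Hermitian with all its eigenvalues in $[-\pi,\pi]$, then $$s(Z)\prec_w\tfrac12\,|\mathrm{Spr}(X)|\prec_w s(X).$$ -/

import Mathlib

noncomputable section

namespace SpectralSpread

open scoped ComplexOrder

/-- The entries of `x` rearranged in non-increasing order. -/
def decr {n : ℕ} (x : Fin n → ℝ) : Fin n → ℝ :=
  x ∘ Tuple.sort (fun i => -x i)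

theorem decr_antitone {n : ℕ} (x : Fin n → ℝ) : Antitone (decr x) := by
  intro i j hij
  have h := Tuple.monotone_sort (fun i => -x i) hij
  simpa [decr] using h

/-- Submajorization (weak majorization): for every `j`, the sum of the `j` largest entries of `x`
is at most the sum of the `j` largest entries of `y`. -/
def Submajorized {n : ℕ} (x y : Fin n → ℝ) : Prop :=
  ∀ j : Fin n, ∑ i ∈ Finset.Iic j, decr x i ≤ ∑ i ∈ Finset.Iic j, decr y i

/-- The eigenvalues of a Hermitian matrix, counted with multiplicity, in non-increasing order. -/
def eigs {n : ℕ} {A : Matrix (Fin n) (Fin n) ℂ} (hA : A.IsHermitian) : Fin n → ℝ :=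
  fun i => hA.eigenvalues₀ (Fin.cast (Fintype.card_fin n).symm i)

theorem eigs_antitone {n : ℕ} {A : Matrix (Fin n) (Fin n) ℂ} (hA : A.IsHermitian) :
    Antitone (eigs hA) :=
  fun _ _ hij => hA.eigenvalues₀_antitone (by simpa using hij)

/-- The full spectral spread `Spr(A)`: its `i`-th entry is the `i`-th largest minus the `i`-th
smallest eigenvalue of `A`. -/
def spr {n : ℕ} {A : Matrix (Fin n) (Fin n) ℂ} (hA : A.IsHermitian) : Fin n → ℝ :=
  fun i => eigs hA i - eigs hA (Fin.rev i)

/-- The `n` singular values of an `n × n` matrix, in non-increasing order. -/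
def sv {n : ℕ} (A : Matrix (Fin n) (Fin n) ℂ) : Fin n → ℝ :=
  fun i => (Matrix.toEuclideanLin A).singularValues i

/-- `U` is a direct rotation from `S` onto `T`: it is unitary, maps `S` onto `T`, and in some
orthonormal basis of `ℂⁿ` (the columns of `W`) whose first `k` vectors span `S` it has the block
form `[[C₀, -S₀*], [S₀, C₁]]` with `C₀`, `C₁` positive semidefinite of sizes `k` and
`m = n - k`. -/
def IsDirectRotation {n : ℕ} (S T : Submodule ℂ (EuclideanSpace ℂ (Fin n)))
    (U : Matrix (Fin n) (Fin n) ℂ) : Prop :=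
  U ∈ Matrix.unitaryGroup (Fin n) ℂ ∧
  S.map (Matrix.toEuclideanLin U) = T ∧
  ∃ (k m : ℕ) (h : k + m = n) (W : Matrix (Fin n) (Fin n) ℂ)
    (C₀ : Matrix (Fin k) (Fin k) ℂ) (C₁ : Matrix (Fin m) (Fin m) ℂ)
    (S₀ : Matrix (Fin m) (Fin k) ℂ),
    W ∈ Matrix.unitaryGroup (Fin n) ℂ ∧
    Submodule.span ℂ (Set.range fun j : Fin k =>
      (WithLp.toLp 2 (W.col (Fin.cast h (Fin.castAdd m j))) : EuclideanSpace ℂ (Fin n))) = S ∧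
    C₀.PosSemidef ∧ C₁.PosSemidef ∧
    W.conjTranspose * U * W =
      Matrix.reindex (finSumFinEquiv.trans (finCongr h)) (finSumFinEquiv.trans (finCongr h))
        (Matrix.fromBlocks C₀ (-S₀.conjTranspose) S₀ C₁)

end SpectralSpread

end

/-! ### Weak majorization and sums of spreads of real sequences. -/

section

namespace SpectralSpread

open Finset

/-! Let `R` be the reflection that is `1` on `S` and `-1` on its orthogonal complement. The block
form of the direct rotation gives `U R = R Uᴴ` and `U + Uᴴ ≥ 0`. The latter puts every eigenvalue of
`Z` in `[-π/2, π/2]`. Since `U` and `e^{iX}` both carry `S` onto `T`, they move `R` to the same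
reflection.

Take orthonormal eigenvectors `V` of `U` with angles `θ j > 0`. The reflection exchanges the
eigenvalues `e^{±iθ}`, so `L = (V + R V)/√2` is an isometry. Along `R_t = e^{itX} R e^{-itX}` the
compression `Lᴴ R_t L` goes from `1` to the diagonal matrix of `cos (2 θ j)`, so the trace of its
`arccos` grows from `0` to `2 ∑ θ j`. The speed of this trace is at most the sum of the first `m`
entries of `Spr X`, with `m` the number of angles. As `arccos` is singular at `±1`, polynomials
approximating `-arccos` replace it. This is `two_mul_sum_angles_le`, resting on
`norm_trace_aeval_sub_le` and `exists_polynomial_arccos`.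

Negative angles are treated in the same way through `R V`. The two families use opposite ends of the
antisymmetric vector `Spr X`, so the bounds add up to the first majorization
(`abs_submajorized_spread`). The second is the triangle inequality (`submajorized_abs_spread`). -/

theorem sum_sub_mul_le {ι : Type*} [Fintype ι] (l a : ι → ℝ) (A : Finset ι) (c : ℝ)
    (hA : ∀ i ∈ A, c ≤ l i) (hA' : ∀ i ∉ A, l i ≤ c) (h0 : ∀ i, 0 ≤ a i) (h1 : ∀ i, a i ≤ 1) :
    ∑ i, (l i - c) * a i ≤ ∑ i ∈ A, (l i - c) := by
  classical
  rw [← Finset.sum_filter_add_sum_filter_not univ (· ∈ A)]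
  have e1 : ∑ i ∈ univ.filter (· ∈ A), (l i - c) * a i ≤ ∑ i ∈ A, (l i - c) := by
    rw [Finset.filter_mem_eq_inter, univ_inter]
    refine Finset.sum_le_sum fun i hi => ?_
    nlinarith [hA i hi, h1 i]
  have e2 : ∑ i ∈ univ.filter (¬ · ∈ A), (l i - c) * a i ≤ 0 := by
    refine Finset.sum_nonpos fun i hi => ?_
    nlinarith [hA' i (by simpa using hi), h0 i]
  linarith

/-- The first `m` indices of `Fin n`. -/
def firstIdx (n m : ℕ) : Finset (Fin n) := univ.filter fun i => i.val < m

@[simp] theorem mem_firstIdx {n m : ℕ} {i : Fin n} : i ∈ firstIdx n m ↔ i.val < m := by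
  simp [firstIdx]

theorem card_firstIdx {n m : ℕ} (h : m ≤ n) : (firstIdx n m).card = m := by
  have : firstIdx n m = univ.map (Fin.castLEEmb h) := by
    ext i
    simp only [mem_firstIdx, mem_map, mem_univ, true_and, Fin.coe_castLEEmb]
    exact ⟨fun hi => ⟨⟨i, hi⟩, rfl⟩, by rintro ⟨j, rfl⟩; exact j.2⟩
  simp [this]

/-- The positive and negative parts of `k` have equal mass, at most `m`, and entries at most `1`.
The best choice puts the positive mass on the `m` largest values of `l` and the negative mass on the
`m` smallest. -/
theorem sum_mul_le_sum_spread {n m : ℕ} {l : Fin n → ℝ} (hl : Antitone l) (hm : 2 * m ≤ n)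
    (k : Fin n → ℝ) (h1 : ∀ i, |k i| ≤ 1) (h0 : ∑ i, k i = 0) (hs : ∑ i, |k i| ≤ 2 * m) :
    ∑ i, l i * k i ≤ ∑ i ∈ firstIdx n m, (l i - l (Fin.rev i)) := by
  rcases Nat.eq_zero_or_pos m with rfl | hmpos
  · have hk : ∀ i, k i = 0 := fun i => abs_eq_zero.mp <|
      (Finset.sum_eq_zero_iff_of_nonneg fun i _ => abs_nonneg (k i)).mp
        (le_antisymm (by simpa using hs) (Finset.sum_nonneg fun i _ => abs_nonneg _)) i (mem_univ i)
    simp [hk, firstIdx]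
  -- The last of the first `m` indices; `l i₀` and `l (Fin.rev i₀)` are the thresholds for the two
  -- parts.
  let i₀ : Fin n := ⟨m - 1, by omega⟩
  have hpa : ∀ i, (k i)⁺ - (k i)⁻ = k i := fun i => posPart_sub_negPart _
  have hpb : ∀ i, (k i)⁺ + (k i)⁻ = |k i| := fun i => posPart_add_negPart _
  have p0 : ∀ i, 0 ≤ (k i)⁺ := fun i => posPart_nonneg _
  have n0 : ∀ i, 0 ≤ (k i)⁻ := fun i => negPart_nonneg _
  have hpe : ∑ i, (k i)⁺ - ∑ i, (k i)⁻ = 0 := by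
    rw [← Finset.sum_sub_distrib, ← h0]; exact Finset.sum_congr rfl fun i _ => hpa i
  have hpl : ∑ i, (k i)⁺ + ∑ i, (k i)⁻ ≤ 2 * m := by
    rw [← Finset.sum_add_distrib]; exact le_trans (Finset.sum_congr rfl fun i _ => hpb i).le hs
  have b1 := sum_sub_mul_le l (fun i => (k i)⁺) (firstIdx n m) (l i₀)
    (fun i hi => hl (by rw [Fin.le_def]; simp at hi; simp [i₀]; omega))
    (fun i hi => hl (by rw [Fin.le_def]; simp at hi; simp [i₀]; omega))
    p0 (fun i => by linarith [h1 i, hpb i, n0 i])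
  have b2 := sum_sub_mul_le (fun i => -l (Fin.rev i)) (fun i => (k (Fin.rev i))⁻) (firstIdx n m)
    (-l (Fin.rev i₀))
    (fun i hi => neg_le_neg (hl (by rw [Fin.rev_le_rev, Fin.le_def]; simp at hi; simp [i₀]; omega)))
    (fun i hi => neg_le_neg (hl (by rw [Fin.rev_le_rev, Fin.le_def]; simp at hi; simp [i₀]; omega)))
    (fun i => n0 _) (fun i => by linarith [h1 (Fin.rev i), hpb (Fin.rev i), p0 (Fin.rev i)])
  have hrev : ∑ i, (-l (Fin.rev i) - -l (Fin.rev i₀)) * (k (Fin.rev i))⁻ =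
      ∑ i, (-l i - -l (Fin.rev i₀)) * (k i)⁻ :=
    Equiv.sum_comp Fin.revPerm fun i => (-l i - -l (Fin.rev i₀)) * (k i)⁻
  rw [hrev] at b2
  have hc : l (Fin.rev i₀) ≤ l i₀ := hl (by rw [Fin.le_def]; simp [i₀]; omega)
  have hcard : ((firstIdx n m).card : ℝ) = m := by rw [card_firstIdx (by omega)]
  simp only [Finset.sum_sub_distrib, Finset.sum_const, nsmul_eq_mul, hcard, sub_mul,
    ← Finset.mul_sum, Finset.sum_neg_distrib, neg_mul] at b1 b2
  have e : ∑ i, l i * k i = ∑ i, l i * (k i)⁺ - ∑ i, l i * (k i)⁻ := by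
    rw [← Finset.sum_sub_distrib]
    exact Finset.sum_congr rfl fun i _ => by rw [← mul_sub, hpa]
  rw [Finset.sum_sub_distrib, e]
  have hle : ∑ i, (k i)⁺ ≤ m := by linarith
  have hp : ∑ i, (k i)⁻ = ∑ i, (k i)⁺ := by linarith
  rw [hp] at b2
  -- The slack is the gap between the thresholds times the unused mass `m - ∑ (k i)⁺`.
  nlinarith [mul_nonneg (sub_nonneg.2 hc) (sub_nonneg.2 hle)]

theorem sum_le_sum_decr {n : ℕ} (x : Fin n → ℝ) (j : Fin n) (A : Finset (Fin n))
    (hA : A.card = j + 1) : ∑ i ∈ A, x i ≤ ∑ i ∈ Iic j, decr x i := by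
  classical
  let σ := Tuple.sort (fun i => -x i)
  have hx : ∑ i ∈ A, x i = ∑ i ∈ A.map σ.symm.toEmbedding, decr x i := by
    rw [Finset.sum_map]
    exact Finset.sum_congr rfl fun i _ => by simp [decr, σ]
  rw [hx]
  set B := A.map σ.symm.toEmbedding with hB
  have hBc : B.card = j + 1 := by rw [hB, card_map, hA]
  have h := sum_sub_mul_le (decr x) (fun i => if i ∈ B then 1 else 0) (Iic j) (decr x j)
    (fun i hi => decr_antitone x (by simpa using hi))
    (fun i hi => decr_antitone x (le_of_not_ge (by simpa using hi)))
    (fun i => by split_ifs <;> norm_num) (fun i => by split_ifs <;> norm_num)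
  simp only [mul_ite, mul_one, mul_zero, Finset.sum_ite_mem, univ_inter, Finset.sum_sub_distrib,
    Finset.sum_const, hBc, Fin.card_Iic] at h
  linarith

theorem exists_sum_eq_sum_decr {n : ℕ} (x : Fin n → ℝ) (j : Fin n) :
    ∃ A : Finset (Fin n), A.card = j + 1 ∧ ∑ i ∈ A, x i = ∑ i ∈ Iic j, decr x i :=
  ⟨(Iic j).map (Tuple.sort (fun i => -x i)).toEmbedding, by simp, by
    rw [Finset.sum_map]; rfl⟩

/-- A smaller `B` suffices because it can be padded with nonnegative entries of `y`. -/
theorem submajorized_of_forall_exists {n : ℕ} {x y : Fin n → ℝ} (hy : ∀ i, 0 ≤ y i)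
    (h : ∀ A : Finset (Fin n), ∃ B : Finset (Fin n), B.card ≤ A.card ∧
      ∑ i ∈ A, x i ≤ ∑ i ∈ B, y i) : Submajorized x y := by
  intro j
  obtain ⟨A, hA, hAx⟩ := exists_sum_eq_sum_decr x j
  obtain ⟨B, hB, hBA⟩ := h A
  obtain ⟨C, hBC, -, hC⟩ := Finset.exists_subsuperset_card_eq (subset_univ B) (hA ▸ hB)
    (by simp)
  calc _ = ∑ i ∈ A, x i := hAx.symm
    _ ≤ ∑ i ∈ B, y i := hBA
    _ ≤ ∑ i ∈ C, y i := Finset.sum_le_sum_of_subset_of_nonneg hBC fun i _ _ => hy i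
    _ ≤ _ := sum_le_sum_decr y j C hC

/-- By the triangle inequality the sum over `A` is at most the mean of the sums of `|l|` over `A`
and over its reversal; the larger of these serves. -/
theorem submajorized_abs_spread {n : ℕ} (l : Fin n → ℝ) (σ : Equiv.Perm (Fin n)) :
    Submajorized (fun i => (1 / 2 : ℝ) * |l i - l (Fin.rev i)|) (fun i => |l (σ i)|) := by
  refine submajorized_of_forall_exists (fun i => abs_nonneg _) fun A => ?_
  have key : ∑ i ∈ A, (1 / 2 : ℝ) * |l i - l (Fin.rev i)| ≤
      (1 / 2 : ℝ) * (∑ i ∈ A, |l i|) + 1 / 2 * (∑ i ∈ A.map Fin.revPerm.toEmbedding, |l i|) := by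
    rw [Finset.sum_map, Finset.mul_sum, Finset.mul_sum, ← Finset.sum_add_distrib]
    refine Finset.sum_le_sum fun i _ => ?_
    have := abs_sub (l i) (l (Fin.rev i))
    simp only [Equiv.coe_toEmbedding, Fin.revPerm_apply]
    linarith
  have hσ : ∀ B : Finset (Fin n), ∑ i ∈ B.map σ.symm.toEmbedding, |l (σ i)| = ∑ i ∈ B, |l i| :=
    fun B => by simp [Finset.sum_map]
  rcases le_total (∑ i ∈ A, |l i|) (∑ i ∈ A.map Fin.revPerm.toEmbedding, |l i|) with h | h
  · exact ⟨(A.map Fin.revPerm.toEmbedding).map σ.symm.toEmbedding, by simp, by rw [hσ]; linarith⟩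
  · exact ⟨A.map σ.symm.toEmbedding, by simp, by rw [hσ]; linarith⟩

/-- If the positive and the negative parts of `x` are dominated by partial sums of the spread of
`l`, then `|x|` is submajorized by half the absolute spread. -/
theorem abs_submajorized_spread {n : ℕ} {x l : Fin n → ℝ}
    (σ : Equiv.Perm (Fin n))
    (hpos : ∀ A : Finset (Fin n), (∀ i ∈ A, 0 < x i) →
      2 * A.card ≤ n ∧ 2 * ∑ i ∈ A, x i ≤ ∑ i ∈ firstIdx n A.card, (l i - l (Fin.rev i)))
    (hneg : ∀ A : Finset (Fin n), (∀ i ∈ A, x i < 0) →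
      2 * A.card ≤ n ∧ 2 * ∑ i ∈ A, -x i ≤ ∑ i ∈ firstIdx n A.card, (l i - l (Fin.rev i))) :
    Submajorized (fun i => |x (σ i)|) (fun i => (1 / 2 : ℝ) * |l i - l (Fin.rev i)|) := by
  classical
  refine submajorized_of_forall_exists (fun i => by positivity) fun A₀ => ?_
  set A := A₀.map σ.toEmbedding with hA
  have hAc : A.card = A₀.card := by simp [hA]
  have hAs : ∑ i ∈ A₀, |x (σ i)| = ∑ i ∈ A, |x i| := by simp [hA, Finset.sum_map]
  rw [hAs, ← hAc]
  obtain ⟨p2, hp⟩ := hpos (A.filter (0 < x ·)) (by simp)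
  obtain ⟨q2, hq⟩ := hneg (A.filter (x · < 0)) (by simp)
  set p := (A.filter (0 < x ·)).card
  set q := (A.filter (x · < 0)).card
  have hpq : p + q ≤ A.card := by
    rw [← Finset.card_union_of_disjoint]
    · exact card_le_card (union_subset (filter_subset _ _) (filter_subset _ _))
    · exact Finset.disjoint_filter.2 fun i _ h h' => lt_asymm h h'
  have hsum : ∑ i ∈ A, |x i| = ∑ i ∈ A.filter (0 < x ·), x i + ∑ i ∈ A.filter (x · < 0), -x i := by
    rw [Finset.sum_filter, Finset.sum_filter, ← Finset.sum_add_distrib]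
    refine Finset.sum_congr rfl fun i _ => ?_
    rcases lt_trichotomy (x i) 0 with h | h | h
    · simp [abs_of_neg h, h, h.le]
    · simp [h]
    · simp [abs_of_pos h, h, h.le]
  -- Since `2p ≤ n` and `2q ≤ n`, the first `p` and the last `q` indices do not meet. Reversal only
  -- changes the sign of a spread entry, so the last `q` indices can pay for the negative part.
  have hdis : Disjoint (firstIdx n p) ((firstIdx n q).map Fin.revPerm.toEmbedding) := by
    rw [Finset.disjoint_left]
    intro i hi hi'
    obtain ⟨j, hj, rfl⟩ := Finset.mem_map.1 hi'
    simp at hi hj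
    omega
  refine ⟨(firstIdx n p).disjUnion _ hdis, ?_, ?_⟩
  · rw [card_disjUnion, card_map, card_firstIdx (by omega), card_firstIdx (by omega)]
    exact hpq
  · rw [sum_disjUnion, Finset.sum_map _ Fin.revPerm.toEmbedding, hsum, ← Finset.mul_sum,
      ← Finset.mul_sum]
    have e1 : ∑ i ∈ firstIdx n p, (l i - l (Fin.rev i)) ≤
        ∑ i ∈ firstIdx n p, |l i - l (Fin.rev i)| := Finset.sum_le_sum fun i _ => le_abs_self _
    have e2 : ∑ i ∈ firstIdx n q, (l i - l (Fin.rev i)) ≤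
        ∑ i ∈ firstIdx n q, |l (Fin.revPerm.toEmbedding i) -
          l (Fin.rev (Fin.revPerm.toEmbedding i))| :=
      Finset.sum_le_sum fun i _ => by
        simp only [Equiv.coe_toEmbedding, Fin.revPerm_apply, Fin.rev_rev]
        rw [abs_sub_comm]; exact le_abs_self _
    linarith

end SpectralSpread

end

/-! ### Ordered spectral decomposition and singular values of Hermitian matrices. -/

section

namespace SpectralSpread

open Matrix

theorem exists_perm_eigs {n : ℕ} {A : Matrix (Fin n) (Fin n) ℂ} (hA : A.IsHermitian) :
    ∃ σ : Equiv.Perm (Fin n), ∀ i, eigs hA i = hA.eigenvalues (σ i) := by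
  refine ⟨(finCongr (Fintype.card_fin n).symm).trans
    (Fintype.equivOfCardEq (Fintype.card_fin _)), fun i => ?_⟩
  simp [eigs, IsHermitian.eigenvalues]

/-- Spectral decomposition with the eigenvalues in non-increasing order. -/
theorem exists_unitary_eigs {n : ℕ} {A : Matrix (Fin n) (Fin n) ℂ} (hA : A.IsHermitian) :
    ∃ Q ∈ Matrix.unitaryGroup (Fin n) ℂ,
      A = Q * diagonal (fun i => (eigs hA i : ℂ)) * Qᴴ := by
  obtain ⟨σ, hσ⟩ := exists_perm_eigs hA
  have hs := hA.spectral_theorem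
  rw [Unitary.conjStarAlgAut_apply] at hs
  have hV : (hA.eigenvectorUnitary : Matrix (Fin n) (Fin n) ℂ) ∈ Matrix.unitaryGroup (Fin n) ℂ :=
    hA.eigenvectorUnitary.2
  generalize (hA.eigenvectorUnitary : Matrix (Fin n) (Fin n) ℂ) = V at hs hV
  have hQ : V.submatrix id σ * (V.submatrix id σ)ᴴ = 1 := by
    rw [conjTranspose_submatrix, ← submatrix_mul _ _ _ _ _ σ.bijective, ← star_eq_conjTranspose,
      mem_unitaryGroup_iff.1 hV]
    simp
  refine ⟨V.submatrix id σ, mem_unitaryGroup_iff.2 hQ, ?_⟩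
  have hd : diagonal (fun i => (eigs hA i : ℂ)) =
      (diagonal (RCLike.ofReal ∘ hA.eigenvalues : Fin n → ℂ)).submatrix σ σ := by
    rw [submatrix_diagonal _ _ σ.injective]
    congr 1
    funext i
    simp [hσ]
  rw [hd, conjTranspose_submatrix, ← submatrix_mul _ _ _ _ _ σ.bijective,
    ← submatrix_mul _ _ _ _ _ σ.bijective, submatrix_id_id]
  exact hs

theorem charpoly_eq_prod_of_conj {n : ℕ} {A Q : Matrix (Fin n) (Fin n) ℂ}
    (hQ : Q ∈ Matrix.unitaryGroup (Fin n) ℂ) (d : Fin n → ℂ)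
    (hA : A = Q * diagonal d * Qᴴ) :
    A.charpoly = ∏ i, (Polynomial.X - Polynomial.C (d i)) := by
  rw [hA, charpoly_mul_comm, ← mul_assoc, ← star_eq_conjTranspose, mem_unitaryGroup_iff'.1 hQ,
    one_mul, charpoly_diagonal]

theorem eigenvalues_congr {E : Type*} [NormedAddCommGroup E] [InnerProductSpace ℂ E]
    [FiniteDimensional ℂ E] {T T' : E →ₗ[ℂ] E} (h : T = T') (hT : T.IsSymmetric)
    (hT' : T'.IsSymmetric) {n : ℕ} (hn : Module.finrank ℂ E = n) (i : Fin n) :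
    hT.eigenvalues hn i = hT'.eigenvalues hn i := by
  subst h; rfl

theorem sv_eq_sqrt_eigs {n : ℕ} (A : Matrix (Fin n) (Fin n) ℂ) (i : Fin n) :
    sv A i = √(eigs (isHermitian_conjTranspose_mul_self A) i) := by
  have h : (toEuclideanLin A).adjoint ∘ₗ toEuclideanLin A = toEuclideanLin (Aᴴ * A) := by
    rw [← toEuclideanLin_conjTranspose_eq_adjoint]
    exact (toLpLin_mul_same (p := 2) Aᴴ A).symm
  have h1 := LinearMap.singularValues_of_lt (toEuclideanLin A)
    (n := Fintype.card (Fin n)) finrank_euclideanSpace (i := i) (by simp)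
  rw [sv, h1]
  congr 1
  exact eigenvalues_congr h _ _ _ _

/-- Equal multisets of values mean fibres of equal size; bijections between the fibres glue to `σ`.
-/
theorem exists_perm_of_map_univ_eq {ι α : Type*} [Fintype ι] [DecidableEq α] {f g : ι → α}
    (h : Finset.univ.val.map f = Finset.univ.val.map g) :
    ∃ σ : Equiv.Perm ι, ∀ i, f i = g (σ i) := by
  have hc : ∀ c, Fintype.card {i // f i = c} = Fintype.card {i // g i = c} := fun c => by
    have := congrArg (Multiset.count c) h
    rw [Multiset.count_map, Multiset.count_map] at this
    rw [Fintype.card_subtype, Fintype.card_subtype]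
    simpa only [eq_comm, Finset.card_def, Finset.filter_val] using this
  exact ⟨Equiv.ofFiberEquiv fun c => Fintype.equivOfCardEq (hc c),
    fun i => (Equiv.ofFiberEquiv_map _ i).symm⟩

/-- The singular values of a Hermitian matrix are the absolute values of its eigenvalues. -/
theorem exists_perm_sv {n : ℕ} {A : Matrix (Fin n) (Fin n) ℂ} (hA : A.IsHermitian) :
    ∃ σ : Equiv.Perm (Fin n), ∀ i, sv A i = |eigs hA (σ i)| := by
  obtain ⟨Q, hQ, hAQ⟩ := exists_unitary_eigs hA
  have hQ' : Qᴴ * Q = 1 := mem_unitaryGroup_iff'.1 hQ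
  have hB : (Aᴴ * A).IsHermitian := isHermitian_conjTranspose_mul_self A
  have hsv : ∀ i, sv A i = √(eigs hB i) := fun i => sv_eq_sqrt_eigs A i
  have hBQ : Aᴴ * A = Q * diagonal (fun i => ((eigs hA i ^ 2 : ℝ) : ℂ)) * Qᴴ := by
    rw [hA.eq]
    nth_rw 1 2 [hAQ]
    calc _ = Q * (diagonal (fun i => (eigs hA i : ℂ)) * (Qᴴ * Q) *
          diagonal (fun i => (eigs hA i : ℂ))) * Qᴴ := by simp only [mul_assoc]
      _ = _ := by
        rw [hQ', mul_one, diagonal_mul_diagonal]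
        simp [sq]
  -- Two diagonalizations of `Aᴴ * A`, by squared eigenvalues of `A` and by its own ordered
  -- eigenvalues, share one characteristic polynomial, hence one multiset of roots.
  have hroots := congrArg Polynomial.roots (charpoly_eq_prod_of_conj hQ _ hBQ)
  obtain ⟨R, hR, hBR⟩ := exists_unitary_eigs hB
  rw [charpoly_eq_prod_of_conj hR _ hBR, Polynomial.roots_prod _ _ 
      (Finset.prod_ne_zero_iff.2 fun i _ => Polynomial.X_sub_C_ne_zero _),
    Polynomial.roots_prod _ _ 
      (Finset.prod_ne_zero_iff.2 fun i _ => Polynomial.X_sub_C_ne_zero _)] at hroots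
  simp only [Polynomial.roots_X_sub_C, Multiset.bind_singleton] at hroots
  have hm := congrArg (Multiset.map fun z : ℂ => √z.re) hroots
  simp only [Multiset.map_map, Function.comp_def, Complex.ofReal_re, Real.sqrt_sq_eq_abs] at hm
  obtain ⟨σ, hσ⟩ := exists_perm_of_map_univ_eq hm
  exact ⟨σ, fun i => (hsv i).trans (hσ i)⟩

end SpectralSpread

end

/-! ### Polynomial approximation of `arccos` with a derivative bound. -/

section

namespace SpectralSpread

open Polynomial Set

theorem exists_derivative_eq (q : ℝ[X]) : ∃ p : ℝ[X], derivative p = q := by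
  induction q using Polynomial.induction_on' with
  | add p q hp hq =>
    obtain ⟨a, rfl⟩ := hp
    obtain ⟨b, rfl⟩ := hq
    exact ⟨a + b, by simp⟩
  | monomial k a =>
    refine ⟨monomial (k + 1) (a / (k + 1)), ?_⟩
    rw [derivative_monomial]
    congr 1
    push_cast
    field_simp

/-- Shrinking the argument by `r < 1` moves the singularities of `arcsin'` out of `[-1, 1]`. -/
theorem exists_near_one_arcsin {η : ℝ} (hη : 0 < η) :
    ∃ r : ℝ, 0 < r ∧ r < 1 ∧ ∀ x ∈ Icc (-1 : ℝ) 1, |Real.arcsin (r * x) - Real.arcsin x| < η := by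
  have h := (isCompact_Icc (a := (-1 : ℝ)) (b := 1)).uniformContinuousOn_of_continuous
    Real.continuous_arcsin.continuousOn
  obtain ⟨δ, hδ, h⟩ := Metric.uniformContinuousOn_iff.1 h η hη
  have hm : 0 < min (δ / 2) (1 / 2) := by positivity
  have hm1 := min_le_left (δ / 2) (1 / 2)
  have hm2 := min_le_right (δ / 2) (1 / 2)
  refine ⟨1 - min (δ / 2) (1 / 2), by linarith, by linarith, fun x hx => ?_⟩
  set e := min (δ / 2) (1 / 2)
  refine h _ ⟨?_, ?_⟩ _ hx ?_
  · nlinarith [hx.1, hx.2]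
  · nlinarith [hx.1, hx.2]
  · rw [Real.dist_eq, show (1 - e) * x - x = -(e * x) by ring, abs_neg, abs_mul, abs_of_pos hm]
    have : |x| ≤ 1 := abs_le.2 hx
    nlinarith

/-- A polynomial approximation of `-arccos` whose derivative is dominated by that of `arccos`. -/
theorem exists_polynomial_arccos {η : ℝ} (hη : 0 < η) : ∃ p : ℝ[X],
    (∀ x ∈ Icc (-1 : ℝ) 1, |(derivative p).eval x| * √(1 - x ^ 2) ≤ 1) ∧
    ∀ x ∈ Icc (-1 : ℝ) 1, Real.arccos x - η ≤ p.eval 1 - p.eval x := by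
  obtain ⟨r, hr0, hr1, hr⟩ := exists_near_one_arcsin (show 0 < η / 4 by positivity)
  -- Error budget: `2 * (η / 4) = 6ε` from shrinking, `2ε` from integrating the derivative error
  -- over length at most `2`, and at most `4ε` from dividing by `1 + ε`, as `arccos ≤ π ≤ 4`.
  set ε := η / 12 with hε
  have hε0 : 0 < ε := by positivity
  have hpos : ∀ x ∈ Icc (-1 : ℝ) 1, 0 < 1 - (r * x) ^ 2 := fun x hx => by
    have : x ^ 2 ≤ 1 := by nlinarith [hx.1, hx.2]
    have : r ^ 2 < 1 := by nlinarith
    nlinarith [mul_pow r x 2, sq_nonneg x, sq_nonneg r]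
  have hcont : ContinuousOn (fun x => r / √(1 - (r * x) ^ 2)) (Icc (-1 : ℝ) 1) :=
    ContinuousOn.div (by fun_prop) (by fun_prop) fun x hx => (Real.sqrt_pos.2 (hpos x hx)).ne'
  obtain ⟨q, hq⟩ := exists_polynomial_near_of_continuousOn _ _ _ hcont ε hε0
  obtain ⟨P, rfl⟩ := exists_derivative_eq q
  have hder : ∀ x ∈ Icc (-1 : ℝ) 1, HasDerivWithinAt (fun x => P.eval x - Real.arcsin (r * x))
      ((derivative P).eval x - r / √(1 - (r * x) ^ 2)) (Icc (-1) 1) x := fun x hx => by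
    refine (P.hasDerivAt x).hasDerivWithinAt.sub (HasDerivAt.hasDerivWithinAt ?_)
    have h1 : HasDerivAt (fun x => r * x) r x := by simpa using (hasDerivAt_id x).const_mul r
    have hp := hpos x hx
    have h2 := (Real.hasDerivAt_arcsin (x := r * x) (by nlinarith) (by nlinarith)).comp x h1
    rw [div_mul_eq_mul_div, one_mul] at h2
    exact h2
  have hc : 0 < 1 + ε := by linarith
  -- Approximation may push the weighted derivative up to `1 + ε`; this factor restores the bound
  -- `1`.
  refine ⟨C (1 / (1 + ε)) * P, fun x hx => ?_, fun x hx => ?_⟩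
  · have hs := Real.sqrt_pos.2 (hpos x hx)
    have hb : r / √(1 - (r * x) ^ 2) * √(1 - x ^ 2) ≤ 1 := by
      rw [div_mul_eq_mul_div, div_le_one hs]
      refine Real.le_sqrt_of_sq_le ?_
      have : x ^ 2 ≤ 1 := by nlinarith [hx.1, hx.2]
      rw [mul_pow, Real.sq_sqrt (by linarith)]
      nlinarith
    have hs1 : √(1 - x ^ 2) ≤ 1 := Real.sqrt_le_one.2 (by nlinarith [sq_nonneg x])
    have hs0 := Real.sqrt_nonneg (1 - x ^ 2)
    have hle : |(derivative P).eval x| ≤ r / √(1 - (r * x) ^ 2) + ε := by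
      have h1 := abs_sub_abs_le_abs_sub ((derivative P).eval x) (r / √(1 - (r * x) ^ 2))
      have h2 : |r / √(1 - (r * x) ^ 2)| = r / √(1 - (r * x) ^ 2) := abs_of_pos (by positivity)
      linarith [hq x hx]
    simp only [derivative_mul, derivative_C, zero_mul, zero_add, eval_mul, eval_C, abs_mul]
    rw [abs_of_pos (by positivity), mul_assoc, one_div, inv_mul_le_iff₀ hc, mul_one]
    nlinarith
  · have h1 : (1 : ℝ) ∈ Icc (-1 : ℝ) 1 := by simp
    have hmv := (convex_Icc (-1 : ℝ) 1).norm_image_sub_le_of_norm_hasDerivWithin_le hder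
      (fun y hy => (hq y hy).le) hx h1
    have hn : ‖(1 : ℝ) - x‖ ≤ 2 := by
      rw [Real.norm_eq_abs, abs_le]; constructor <;> linarith [hx.1, hx.2]
    have hmv' := (abs_le.1 (le_trans hmv (mul_le_mul_of_nonneg_left hn hε0.le))).1
    have a1 := (abs_lt.1 (hr x hx)).2
    have a2 := (abs_lt.1 (hr 1 h1)).1
    rw [mul_one] at a2 hmv'
    have hac : Real.arccos x = Real.arcsin 1 - Real.arcsin x := by
      rw [Real.arccos, Real.arcsin_one]
    have hle : Real.arccos x - 8 * ε ≤ P.eval 1 - P.eval x := by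
      rw [hac]; linarith
    have hpi := Real.arccos_le_pi x
    have hpi4 := Real.pi_le_four
    simp only [eval_mul, eval_C]
    rw [← mul_sub, one_div, ← div_eq_inv_mul, le_div_iff₀ hc, show η = 12 * ε by rw [hε]; ring]
    nlinarith [Real.arccos_nonneg x]

end SpectralSpread

end

/-! ### Speed bound for the trace of a polynomial in a compressed reflection. -/

section

namespace SpectralSpread

open Matrix Polynomial

theorem aeval_conj_diagonal {κ : Type*} [Fintype κ] [DecidableEq κ] {Q : Matrix κ κ ℂ}
    (hQ : Q ∈ Matrix.unitaryGroup κ ℂ) (h : κ → ℝ) (p : ℝ[X]) :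
    aeval (Q * diagonal (fun i => (h i : ℂ)) * Qᴴ) p =
      Q * diagonal (fun i => ((p.eval (h i) : ℝ) : ℂ)) * Qᴴ := by
  have hQ1 : Qᴴ * Q = 1 := mem_unitaryGroup_iff'.1 hQ
  have hQ2 : Q * Qᴴ = 1 := mem_unitaryGroup_iff.1 hQ
  have hpow : ∀ k : ℕ, (Q * diagonal (fun i => (h i : ℂ)) * Qᴴ) ^ k =
      Q * diagonal (fun i => (h i : ℂ) ^ k) * Qᴴ := fun k => by
    induction k with
    | zero => simp [hQ2]
    | succ k ih =>
      rw [pow_succ, ih]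
      calc _ = Q * (diagonal (fun i => (h i : ℂ) ^ k) * (Qᴴ * Q) * diagonal (fun i => (h i : ℂ)))
            * Qᴴ := by simp only [Matrix.mul_assoc]
        _ = _ := by rw [hQ1, Matrix.mul_one, diagonal_mul_diagonal]; simp only [pow_succ]
  induction p using Polynomial.induction_on' with
  | add p q hp hq =>
    rw [map_add, hp, hq, ← Matrix.add_mul, ← Matrix.mul_add, diagonal_add]
    simp
  | monomial k a =>
    rw [aeval_monomial, hpow, ← Algebra.smul_def]
    have : diagonal (fun i => (((monomial k a).eval (h i) : ℝ) : ℂ)) =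
        a • diagonal (fun i => (h i : ℂ) ^ k) := by
      rw [← diagonal_smul]
      congr 1
      funext i
      simp
    rw [this]
    simp

/-- Bessel's inequality for a matrix with orthogonal columns of norm at most one. -/
theorem sum_normSq_row_le_one {ι κ : Type*} [Fintype ι] [Fintype κ] [DecidableEq κ]
    {B : Matrix ι κ ℂ} {c : κ → ℝ} (hc : ∀ j, c j ≤ 1)
    (hB : Bᴴ * B = diagonal fun j => (c j : ℂ)) (i : ι) : ∑ j, ‖B i j‖ ^ 2 ≤ 1 := by
  set g := ∑ j, ‖B i j‖ ^ 2 with hg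
  have hg0 : 0 ≤ g := Finset.sum_nonneg fun j _ => by positivity
  have hgg : (B * Bᴴ) i i = (g : ℂ) := by
    rw [mul_apply, hg, Complex.ofReal_sum]
    exact Finset.sum_congr rfl fun j _ => by
      rw [conjTranspose_apply, ← starRingEnd_apply, Complex.mul_conj', Complex.ofReal_pow]
  -- The same diagonal entry, computed in two ways, is at most `g` and at least `g ^ 2`.
  have h1 : ((B * Bᴴ) * (B * Bᴴ)) i i = ((∑ j, c j * ‖B i j‖ ^ 2 : ℝ) : ℂ) := by
    have : (B * Bᴴ) * (B * Bᴴ) = B * diagonal (fun j => (c j : ℂ)) * Bᴴ := by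
      rw [← hB]; simp only [Matrix.mul_assoc]
    rw [this, mul_apply, Complex.ofReal_sum]
    refine Finset.sum_congr rfl fun j _ => ?_
    rw [mul_diagonal, conjTranspose_apply, mul_right_comm, ← starRingEnd_apply, Complex.mul_conj']
    push_cast; ring
  have h2 : ((B * Bᴴ) * (B * Bᴴ)) i i = ((∑ j, ‖(B * Bᴴ) i j‖ ^ 2 : ℝ) : ℂ) := by
    rw [mul_apply, Complex.ofReal_sum]
    refine Finset.sum_congr rfl fun j _ => ?_
    rw [show (B * Bᴴ) j i = star ((B * Bᴴ) i j) by
      rw [← conjTranspose_apply, conjTranspose_mul, conjTranspose_conjTranspose],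
      ← starRingEnd_apply, Complex.mul_conj']; simp
  have h3 : ∑ j, c j * ‖B i j‖ ^ 2 = ∑ j, ‖(B * Bᴴ) i j‖ ^ 2 := by
    exact_mod_cast h1.symm.trans h2
  have h4 : ∑ j, c j * ‖B i j‖ ^ 2 ≤ g :=
    Finset.sum_le_sum fun j _ => mul_le_of_le_one_left (by positivity) (hc j)
  have h5 : g ^ 2 ≤ ∑ j, ‖(B * Bᴴ) i j‖ ^ 2 := by
    have := Finset.single_le_sum (f := fun j => ‖(B * Bᴴ) i j‖ ^ 2)
      (fun j _ => by positivity) (Finset.mem_univ i)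
    simpa [hgg, abs_of_nonneg hg0] using this
  nlinarith

theorem sum_sum_normSq {ι κ : Type*} [Fintype ι] [Fintype κ] [DecidableEq κ]
    {B : Matrix ι κ ℂ} {c : κ → ℝ}
    (hB : Bᴴ * B = diagonal fun j => (c j : ℂ)) : ∑ i, ∑ j, ‖B i j‖ ^ 2 = ∑ j, c j := by
  rw [Finset.sum_comm]
  refine Finset.sum_congr rfl fun j _ => ?_
  have h := congrFun (congrFun hB j) j
  rw [diagonal_apply_eq, mul_apply] at h
  have : (∑ i, Bᴴ j i * B i j) = ((∑ i, ‖B i j‖ ^ 2 : ℝ) : ℂ) := by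
    rw [Complex.ofReal_sum]
    refine Finset.sum_congr rfl fun i _ => ?_
    rw [conjTranspose_apply, ← starRingEnd_apply, Complex.conj_mul']; simp
  exact_mod_cast this.symm.trans h

/-- The trace pairing of a Hermitian diagonal matrix against a commutator-like matrix built from
two mutually orthogonal systems of vectors is bounded by the spread of the diagonal. -/
theorem norm_trace_diagonal_le {n : ℕ} {κ : Type*} [Fintype κ] [DecidableEq κ]
    {l : Fin n → ℝ} (hl : Antitone l) {E F : Matrix (Fin n) κ ℂ} {d c : κ → ℝ}
    (hE : Eᴴ * E = 1) (hEF : Eᴴ * F = 0) (hF : Fᴴ * F = diagonal fun j => (c j : ℂ))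
    (hdc : ∀ j, d j ^ 2 * c j ≤ 1) (hm : 2 * Fintype.card κ ≤ n) :
    ‖(Complex.I • (diagonal (fun j => (d j : ℂ)) *
        (Eᴴ * diagonal (fun i => (l i : ℂ)) * F - Fᴴ * diagonal (fun i => (l i : ℂ)) * E))).trace‖
      ≤ ∑ i ∈ firstIdx n (Fintype.card κ), (l i - l (Fin.rev i)) := by
  set k : Fin n → ℝ := fun i => ∑ j, d j * (-2 * (star (E i j) * F i j).im) with hk
  have htr : (Complex.I • (diagonal (fun j => (d j : ℂ)) *
      (Eᴴ * diagonal (fun i => (l i : ℂ)) * F - Fᴴ * diagonal (fun i => (l i : ℂ)) * E))).trace =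
      ((∑ i, l i * k i : ℝ) : ℂ) := by
    have hterm : ∀ (A B : Matrix (Fin n) κ ℂ) j,
        (Aᴴ * diagonal (fun i => (l i : ℂ)) * B) j j = ∑ i, star (A i j) * l i * B i j :=
      fun A B j => by rw [mul_apply]; simp only [mul_diagonal, conjTranspose_apply]
    rw [trace_smul, trace, smul_eq_mul, Finset.mul_sum]
    simp only [diag_apply, diagonal_mul, Matrix.sub_apply, hterm, ← Finset.sum_sub_distrib,
      hk, Finset.mul_sum, Complex.ofReal_sum]
    rw [Finset.sum_comm]
    refine Finset.sum_congr rfl fun i _ => Finset.sum_congr rfl fun j _ => ?_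
    apply Complex.ext
    · simp; ring
    · simp; right; ring
  -- The columns of `E` and the rescaled columns of `F` form one orthogonal system of norms at most
  -- `1`. Its squared row norms dominate `|k i|`, so Bessel gives `|k i| ≤ 1`, and the total mass is
  -- at most twice the number of columns of `E`.
  have hB : (fromCols E (F * diagonal fun j => (d j : ℂ)))ᴴ *
      fromCols E (F * diagonal fun j => (d j : ℂ)) =
      diagonal fun s => ((Sum.elim (fun _ => (1 : ℝ)) (fun j => d j ^ 2 * c j) s : ℝ) : ℂ) := by
    have hFE : Fᴴ * E = 0 := by
      rw [← conjTranspose_conjTranspose E, ← conjTranspose_mul, hEF, conjTranspose_zero]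
    rw [conjTranspose_fromCols_eq_fromRows_conjTranspose, fromRows_mul_fromCols, hE,
      ← Matrix.mul_assoc, hEF, Matrix.zero_mul, conjTranspose_mul, Matrix.mul_assoc, hFE,
      Matrix.mul_zero, Matrix.mul_assoc, ← Matrix.mul_assoc Fᴴ, hF,
      diagonal_conjTranspose, diagonal_mul_diagonal, diagonal_mul_diagonal, ← diagonal_one,
      fromBlocks_diagonal]
    congr 1
    funext s
    rcases s with s | s <;> simp
    ring
  have hc1 : ∀ s : κ ⊕ κ, Sum.elim (fun _ => (1 : ℝ)) (fun j => d j ^ 2 * c j) s ≤ 1 := by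
    rintro (s | s)
    · simp
    · simpa using hdc s
  have hrow : ∀ i, |k i| ≤
      ∑ s, ‖fromCols E (F * diagonal fun j => (d j : ℂ)) i s‖ ^ 2 := fun i => by
    rw [Fintype.sum_sum_type, ← Finset.sum_add_distrib]
    refine (Finset.abs_sum_le_sum_abs _ _).trans (Finset.sum_le_sum fun j _ => ?_)
    have h1 : |(star (E i j) * F i j).im| ≤ ‖E i j‖ * ‖F i j‖ :=
      (Complex.abs_im_le_norm _).trans (by rw [norm_mul, norm_star])
    simp only [fromCols_apply_inl, fromCols_apply_inr, mul_diagonal, norm_mul, Complex.norm_real,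
      Real.norm_eq_abs, abs_mul, abs_neg, abs_two]
    have := mul_le_mul_of_nonneg_left h1 (abs_nonneg (d j))
    nlinarith [sq_nonneg (‖E i j‖ - ‖F i j‖ * |d j|)]
  have hk1 : ∀ i, |k i| ≤ 1 := fun i => (hrow i).trans (sum_normSq_row_le_one hc1 hB i)
  have hk0 : ∑ i, k i = 0 := by
    rw [hk, Finset.sum_comm]
    refine Finset.sum_eq_zero fun j _ => ?_
    have h := congrArg Complex.im (congrFun (congrFun hEF j) j)
    simp only [mul_apply, conjTranspose_apply, Complex.im_sum, Matrix.zero_apply,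
      Complex.zero_im] at h
    rw [← Finset.mul_sum, ← Finset.mul_sum, h]
    simp
  have hks : ∑ i, |k i| ≤ 2 * (Fintype.card κ : ℕ) := by
    refine (Finset.sum_le_sum fun i _ => hrow i).trans ?_
    rw [sum_sum_normSq hB]
    refine (Finset.sum_le_sum fun s _ => hc1 s).trans ?_
    simp [two_mul]
  rw [htr, Complex.norm_real, Real.norm_eq_abs, abs_le']
  refine ⟨sum_mul_le_sum_spread hl hm k hk1 hk0 hks, ?_⟩
  have := sum_mul_le_sum_spread hl hm (fun i => -k i) (by simpa using hk1) (by simpa using hk0)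
    (by simpa using hks)
  simpa using this

/-- Used with `p` the derivative of the approximating polynomial. The weight `√(1 - x ^ 2)` is the
norm of the part of `R v` orthogonal to the range of `L`, when `v` is the image under `L` of a unit
eigenvector of the compression with eigenvalue `x`. -/
theorem norm_trace_aeval_compression_le {n : ℕ} {κ : Type*} [Fintype κ] [DecidableEq κ]
    {X R : Matrix (Fin n) (Fin n) ℂ} (hX : X.IsHermitian) (hR : R.IsHermitian) (hRR : R * R = 1)
    {L : Matrix (Fin n) κ ℂ} (hL : Lᴴ * L = 1) {p : ℝ[X]}
    (hp : ∀ x ∈ Set.Icc (-1 : ℝ) 1, |p.eval x| * √(1 - x ^ 2) ≤ 1)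
    (hm : 2 * Fintype.card κ ≤ n) :
    ‖(aeval (Lᴴ * R * L) p * (Lᴴ * (Complex.I • (X * R - R * X)) * L)).trace‖ ≤
      ∑ i ∈ firstIdx n (Fintype.card κ), spr hX i := by
  obtain ⟨P, hP, hXP⟩ := exists_unitary_eigs hX
  have hP2 : P * Pᴴ = 1 := mem_unitaryGroup_iff.1 hP
  have hH : (Lᴴ * R * L).IsHermitian := isHermitian_conjTranspose_mul_mul L hR
  have hs := hH.spectral_theorem
  rw [Unitary.conjStarAlgAut_apply] at hs
  have hQ : (hH.eigenvectorUnitary : Matrix κ κ ℂ) ∈ Matrix.unitaryGroup κ ℂ :=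
    hH.eigenvectorUnitary.2
  generalize (hH.eigenvectorUnitary : Matrix κ κ ℂ) = Q at hs hQ
  set h := hH.eigenvalues
  change _ = Q * diagonal (fun i => (h i : ℂ)) * Qᴴ at hs
  have hQ1 : Qᴴ * Q = 1 := mem_unitaryGroup_iff'.1 hQ
  set D : Matrix κ κ ℂ := diagonal (fun i => (h i : ℂ)) with hD
  have hDh : Dᴴ = D := by rw [hD, diagonal_conjTranspose]; congr 1; funext i; simp
  set M := L * Q with hM
  have hMM : Mᴴ * M = 1 := by
    rw [hM, conjTranspose_mul, Matrix.mul_assoc, ← Matrix.mul_assoc Lᴴ, hL, Matrix.one_mul, hQ1]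
  have hMRM : Mᴴ * (R * M) = D := by
    calc _ = Qᴴ * (Lᴴ * R * L) * Q := by rw [hM, conjTranspose_mul]; simp only [Matrix.mul_assoc]
      _ = (Qᴴ * Q) * D * (Qᴴ * Q) := by rw [hs]; simp only [Matrix.mul_assoc]
      _ = D := by rw [hQ1, Matrix.one_mul, Matrix.mul_one]
  -- The component of `R M` orthogonal to the columns of `M`; as `R` is a unitary involution, its
  -- columns are orthogonal with squared norms `1 - h j ^ 2`.
  set N := R * M - M * D with hN
  have hMN : Mᴴ * N = 0 := by rw [hN, Matrix.mul_sub, hMRM, ← Matrix.mul_assoc, hMM,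
    Matrix.one_mul, sub_self]
  have hNh : Nᴴ = Mᴴ * R - D * Mᴴ := by
    rw [hN, conjTranspose_sub, conjTranspose_mul M D, conjTranspose_mul R M, hR.eq, hDh]
  have hNN : Nᴴ * N = diagonal fun j => ((1 - h j ^ 2 : ℝ) : ℂ) := by
    rw [hNh, Matrix.sub_mul, Matrix.mul_assoc D, hMN, Matrix.mul_zero, sub_zero, hN,
      Matrix.mul_sub, Matrix.mul_assoc Mᴴ R (R * M),
      ← Matrix.mul_assoc R R, hRR, Matrix.one_mul, hMM, ← Matrix.mul_assoc,
      Matrix.mul_assoc Mᴴ R M, hMRM, hD,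
      diagonal_mul_diagonal, ← diagonal_one, diagonal_sub]
    congr 1
    funext j
    push_cast; ring
  have hc0 : ∀ j, 0 ≤ 1 - h j ^ 2 := fun j => by
    have := congrFun (congrFun hNN j) j
    rw [diagonal_apply_eq, mul_apply] at this
    have e : (∑ i, Nᴴ j i * N i j) = ((∑ i, ‖N i j‖ ^ 2 : ℝ) : ℂ) := by
      rw [Complex.ofReal_sum]
      refine Finset.sum_congr rfl fun i _ => ?_
      rw [conjTranspose_apply, ← starRingEnd_apply, Complex.conj_mul']; simp
    have e2 : (∑ i, ‖N i j‖ ^ 2 : ℝ) = 1 - h j ^ 2 := by exact_mod_cast e.symm.trans this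
    rw [← e2]
    positivity
  have hdc : ∀ j, (p.eval (h j)) ^ 2 * (1 - h j ^ 2) ≤ 1 := fun j => by
    have h1 := hp (h j) (abs_le.1 ((sq_le_one_iff_abs_le_one _).1 (by linarith [hc0 j])))
    have h2 : (|p.eval (h j)| * √(1 - h j ^ 2)) ^ 2 ≤ 1 :=
      pow_le_one₀ (by positivity) h1
    rwa [mul_pow, sq_abs, Real.sq_sqrt (hc0 j)] at h2
  have hE : (Pᴴ * M)ᴴ * (Pᴴ * M) = 1 := by
    rw [conjTranspose_mul, conjTranspose_conjTranspose, Matrix.mul_assoc, ← Matrix.mul_assoc P,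
      hP2, Matrix.one_mul, hMM]
  have hEF : (Pᴴ * M)ᴴ * (Pᴴ * N) = 0 := by
    rw [conjTranspose_mul, conjTranspose_conjTranspose, Matrix.mul_assoc, ← Matrix.mul_assoc P,
      hP2, Matrix.one_mul, hMN]
  have hF : (Pᴴ * N)ᴴ * (Pᴴ * N) = diagonal fun j => ((1 - h j ^ 2 : ℝ) : ℂ) := by
    rw [conjTranspose_mul, conjTranspose_conjTranspose, Matrix.mul_assoc, ← Matrix.mul_assoc P,
      hP2, Matrix.one_mul, hNN]
  have key := norm_trace_diagonal_le (eigs_antitone hX)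
    (d := fun j => p.eval (h j)) hE hEF hF hdc hm
  refine le_trans (le_of_eq ?_) key
  congr 1
  rw [hs, aeval_conj_diagonal hQ h p]
  set dp : Matrix κ κ ℂ := diagonal (fun i => ((p.eval (h i) : ℝ) : ℂ)) with hdp
  have e1 : (Pᴴ * M)ᴴ * diagonal (fun i => (eigs hX i : ℂ)) * (Pᴴ * N) = Mᴴ * X * N := by
    conv_rhs => rw [hXP]
    rw [conjTranspose_mul, conjTranspose_conjTranspose]; simp only [Matrix.mul_assoc]
  have e2 : (Pᴴ * N)ᴴ * diagonal (fun i => (eigs hX i : ℂ)) * (Pᴴ * M) = Nᴴ * X * M := by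
    conv_rhs => rw [hXP]
    rw [conjTranspose_mul, conjTranspose_conjTranspose]; simp only [Matrix.mul_assoc]
  rw [e1, e2]
  have hcomm : dp * D = D * dp := by
    rw [hdp, hD, diagonal_mul_diagonal, diagonal_mul_diagonal]; congr 1; funext i; ring
  -- Passing from `R M` to `N` costs a commutator with `D`, whose trace against `dp` vanishes
  -- because `dp` and `D` commute.
  have e3 : Mᴴ * X * N - Nᴴ * X * M = Mᴴ * (X * R - R * X) * M -
      (Mᴴ * X * M * D - D * (Mᴴ * X * M)) := by
    rw [hNh, hN]; simp only [Matrix.mul_sub, Matrix.sub_mul, Matrix.mul_assoc]; abel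
  have e4 : (dp * (Mᴴ * X * M * D - D * (Mᴴ * X * M))).trace = 0 := by
    rw [Matrix.mul_sub, trace_sub, ← Matrix.mul_assoc dp D, hcomm, ← Matrix.mul_assoc dp,
      trace_mul_comm _ D,
      ← Matrix.mul_assoc, sub_self]
  rw [trace_smul, e3, Matrix.mul_sub, trace_sub, e4, sub_zero, Matrix.mul_smul, Matrix.smul_mul,
    Matrix.mul_smul, trace_smul]
  congr 1
  rw [hM, conjTranspose_mul, Matrix.mul_assoc Q, Matrix.mul_assoc Q, trace_mul_comm Q]
  simp only [Matrix.mul_assoc]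

end SpectralSpread

end

/-! ### Moving the reflection along `e^{itX}` and bounding the angles. -/

section

namespace SpectralSpread

open Matrix Polynomial

section Derivative

attribute [local instance] Matrix.linftyOpNormedRing Matrix.linftyOpNormedAlgebra

/-- `A t` and `A'` need not commute, so the power rule holds only under the trace, by cyclicity. The
commuting factor `B` is there to absorb an `A t` in the induction. -/
theorem exists_hasDerivAt_pow {κ : Type*} [Fintype κ] [DecidableEq κ] {A : ℝ → Matrix κ κ ℂ}
    {A' : Matrix κ κ ℂ} {t : ℝ} (hA : HasDerivAt A A' t) (k : ℕ) :
    ∃ D, HasDerivAt (fun s => A s ^ k) D t ∧ ∀ B, Commute B (A t) →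
      (B * D).trace = k * (B * A t ^ (k - 1) * A').trace := by
  induction k with
  | zero => exact ⟨0, by simp only [pow_zero]; exact hasDerivAt_const t _, by simp⟩
  | succ k ih =>
    obtain ⟨D, hD, hB⟩ := ih
    refine ⟨D * A t + A t ^ k * A', by simp only [pow_succ]; exact hD.mul hA, fun B hBA => ?_⟩
    have h1 : (B * (D * A t)).trace = (B * A t * D).trace := by
      rw [← Matrix.mul_assoc, trace_mul_comm, ← Matrix.mul_assoc, hBA.eq]
    rw [Matrix.mul_add, trace_add, h1, hB _ (hBA.mul_left (Commute.refl _)), ← Matrix.mul_assoc B]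
    rcases k with _ | k
    · simp
    · rw [Matrix.mul_assoc B (A t), ← pow_succ']
      simp only [Nat.add_sub_cancel]
      push_cast
      ring

theorem hasDerivAt_trace_comp {κ ι : Type*} [Fintype κ] [DecidableEq κ] [Fintype ι] [DecidableEq ι]
    (M : Matrix κ ι ℂ) (N : Matrix ι κ ℂ) {A : ℝ → Matrix ι ι ℂ} {A' : Matrix ι ι ℂ} {t : ℝ}
    (hA : HasDerivAt A A' t) : HasDerivAt (fun s => M * A s * N) (M * A' * N) t := by
  let f : Matrix ι ι ℂ →ₗ[ℝ] Matrix κ κ ℂ :=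
    { toFun := fun B => M * B * N
      map_add' := fun B C => by rw [Matrix.mul_add, Matrix.add_mul]
      map_smul' := fun r B => by simp }
  exact (LinearMap.toContinuousLinearMap f).hasFDerivAt.comp_hasDerivAt t hA

theorem hasDerivAt_trace {κ : Type*} [Fintype κ] [DecidableEq κ] {A : ℝ → Matrix κ κ ℂ}
    {A' : Matrix κ κ ℂ} {t : ℝ} (hA : HasDerivAt A A' t) :
    HasDerivAt (fun s => (A s).trace) A'.trace t :=
  (LinearMap.toContinuousLinearMap (Matrix.traceLinearMap κ ℝ ℂ)).hasFDerivAt.comp_hasDerivAt t hA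

theorem hasDerivAt_trace_aeval {κ : Type*} [Fintype κ] [DecidableEq κ] {A : ℝ → Matrix κ κ ℂ}
    {A' : Matrix κ κ ℂ} {t : ℝ} (hA : HasDerivAt A A' t) (p : ℝ[X]) :
    HasDerivAt (fun s => (aeval (A s) p).trace) (aeval (A t) (derivative p) * A').trace t := by
  induction p using Polynomial.induction_on' with
  | add p q hp hq =>
    simp only [map_add, trace_add, Matrix.add_mul]
    exact hp.add hq
  | monomial k a =>
    obtain ⟨D, hD, hB⟩ := exists_hasDerivAt_pow hA k
    have h1 := (hasDerivAt_trace hD).const_smul a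
    have h2 := hB 1 (Commute.one_left _)
    simp only [Matrix.one_mul] at h2
    simp only [aeval_monomial, derivative_monomial, ← Algebra.smul_def, trace_smul,
      Matrix.smul_mul]
    have h3 : (a * k) • (A t ^ (k - 1) * A').trace = a • D.trace := by
      rw [h2, Complex.real_smul, Complex.real_smul]
      push_cast
      ring
    rw [h3]
    exact h1

theorem hasDerivAt_exp_conj {n : ℕ} (A R : Matrix (Fin n) (Fin n) ℂ) (t : ℝ) :
    HasDerivAt (fun s : ℝ => NormedSpace.exp (s • A) * R * NormedSpace.exp (s • -A))
      (A * (NormedSpace.exp (t • A) * R * NormedSpace.exp (t • -A)) -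
        NormedSpace.exp (t • A) * R * NormedSpace.exp (t • -A) * A) t := by
  have h1 : HasDerivAt (fun s : ℝ => NormedSpace.exp (s • A)) (A * NormedSpace.exp (t • A)) t :=
    hasDerivAt_exp_smul_const' A t
  have h2 : HasDerivAt (fun s : ℝ => NormedSpace.exp (s • -A)) (NormedSpace.exp (t • -A) * -A) t :=
    hasDerivAt_exp_smul_const (-A) t
  have h3 := (h1.mul_const R).mul h2
  have e : A * (NormedSpace.exp (t • A) * R * NormedSpace.exp (t • -A)) -
      NormedSpace.exp (t • A) * R * NormedSpace.exp (t • -A) * A =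
      A * NormedSpace.exp (t • A) * R * NormedSpace.exp (t • -A) +
        NormedSpace.exp (t • A) * R * (NormedSpace.exp (t • -A) * -A) := by
    simp only [Matrix.mul_assoc, Matrix.mul_neg]
    abel
  rw [e]
  exact h3

theorem exp_mul_exp_neg {n : ℕ} (A : Matrix (Fin n) (Fin n) ℂ) :
    NormedSpace.exp A * NormedSpace.exp (-A) = 1 := by
  rw [← Matrix.exp_add_of_commute _ _ (Commute.neg_right (Commute.refl A)), add_neg_cancel,
    NormedSpace.exp_zero]

/-- The trace of a polynomial in the compression of a reflection moves along
`t ↦ exp (i t X)` at a speed bounded by the spread of `X`. -/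
theorem norm_trace_aeval_sub_le {n : ℕ} {κ : Type*} [Fintype κ] [DecidableEq κ]
    {X R : Matrix (Fin n) (Fin n) ℂ} (hX : X.IsHermitian) (hR : R.IsHermitian) (hRR : R * R = 1)
    {L : Matrix (Fin n) κ ℂ} (hL : Lᴴ * L = 1) {p : ℝ[X]}
    (hp : ∀ x ∈ Set.Icc (-1 : ℝ) 1, |(derivative p).eval x| * √(1 - x ^ 2) ≤ 1)
    (hm : 2 * Fintype.card κ ≤ n) :
    ‖(aeval (Lᴴ * (NormedSpace.exp (Complex.I • X) * R * NormedSpace.exp (-(Complex.I • X))) * L)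
        p).trace - (aeval (Lᴴ * R * L) p).trace‖ ≤
      ∑ i ∈ firstIdx n (Fintype.card κ), spr hX i := by
  set A := Complex.I • X with hA
  have hAh : Aᴴ = -A := by rw [hA, conjTranspose_smul, hX.eq]; simp
  let Rt : ℝ → Matrix (Fin n) (Fin n) ℂ :=
    fun s => NormedSpace.exp (s • A) * R * NormedSpace.exp (s • -A)
  have hEh : ∀ s : ℝ, (NormedSpace.exp (s • A))ᴴ = NormedSpace.exp (s • -A) := fun s => by
    rw [← Matrix.exp_conjTranspose, conjTranspose_smul, hAh]; simp
  have hRt : ∀ s, (Rt s).IsHermitian := fun s => by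
    change (NormedSpace.exp (s • A) * R * NormedSpace.exp (s • -A))ᴴ = _
    rw [conjTranspose_mul, conjTranspose_mul, ← hEh, conjTranspose_conjTranspose, hR.eq, hEh,
      ← Matrix.mul_assoc]
  have hRR1 : ∀ s, Rt s * Rt s = 1 := fun s => by
    have e1 : NormedSpace.exp (s • A) * NormedSpace.exp (s • -A) = 1 := by
      rw [smul_neg]; exact exp_mul_exp_neg _
    have e2 : NormedSpace.exp (s • -A) * NormedSpace.exp (s • A) = 1 := mul_eq_one_comm.1 e1
    calc _ = NormedSpace.exp (s • A) * (R * (NormedSpace.exp (s • -A) * NormedSpace.exp (s • A)) * R)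
          * NormedSpace.exp (s • -A) := by simp only [Rt, Matrix.mul_assoc]
      _ = 1 := by rw [e2, Matrix.mul_one, hRR, Matrix.mul_one, e1]
  have hder : ∀ t ∈ Set.Icc (0 : ℝ) 1, HasDerivWithinAt (fun s => (aeval (Lᴴ * Rt s * L) p).trace)
      (aeval (Lᴴ * Rt t * L) (derivative p) * (Lᴴ * (A * Rt t - Rt t * A) * L)).trace
      (Set.Icc 0 1) t := fun t _ =>
    (hasDerivAt_trace_aeval (hasDerivAt_trace_comp Lᴴ L (hasDerivAt_exp_conj A R t))
      p).hasDerivWithinAt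
  have h := norm_image_sub_le_of_norm_deriv_le_segment_01' hder fun t _ => by
    have := norm_trace_aeval_compression_le hX (hRt t) (hRR1 t) hL hp hm
    rwa [show A * Rt t - Rt t * A = Complex.I • (X * Rt t - Rt t * X) by
      rw [hA, Matrix.smul_mul, Matrix.mul_smul, smul_sub]]
  simpa [Rt] using h

end Derivative

theorem two_mul_card_le_of_orthonormal {n : ℕ} {κ : Type*} [Fintype κ] [DecidableEq κ]
    {V W : Matrix (Fin n) κ ℂ} (hV : Vᴴ * V = 1) (hW : Wᴴ * W = 1) (hVW : Vᴴ * W = 0) :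
    2 * Fintype.card κ ≤ n := by
  have hWV : Wᴴ * V = 0 := by
    rw [← conjTranspose_conjTranspose V, ← conjTranspose_mul, hVW, conjTranspose_zero]
  have h : (fromCols V W)ᴴ * fromCols V W = 1 := by
    rw [conjTranspose_fromCols_eq_fromRows_conjTranspose, fromRows_mul_fromCols, hV, hW, hVW, hWV,
      fromBlocks_one]
  have hr : (1 : Matrix (κ ⊕ κ) (κ ⊕ κ) ℂ).rank ≤ n := by
    rw [← h]
    refine (rank_mul_le_right _ _).trans ((rank_le_card_height _).trans (by simp))
  rw [rank_one, Fintype.card_sum] at hr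
  omega

/-- Angles of a rotation that is inverted by the reflection `R` are controlled by the spread of any
Hermitian `X` whose exponential moves `R` in the same way. -/
theorem two_mul_sum_angles_le {n : ℕ} {κ : Type*} [Fintype κ] [DecidableEq κ]
    {X R U : Matrix (Fin n) (Fin n) ℂ} (hX : X.IsHermitian) (hR : R.IsHermitian) (hRR : R * R = 1)
    (hU : Uᴴ * U = 1) (hUR : U * R = R * Uᴴ)
    (hURX : U * R * Uᴴ = NormedSpace.exp (Complex.I • X) * R * NormedSpace.exp (-(Complex.I • X)))
    {V : Matrix (Fin n) κ ℂ} (hV : Vᴴ * V = 1) {θ : κ → ℝ}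
    (hθ : ∀ j, 0 < θ j ∧ θ j ≤ Real.pi / 2)
    (hUV : U * V = V * diagonal fun j => Complex.exp (θ j * Complex.I)) :
    2 * Fintype.card κ ≤ n ∧
      2 * ∑ j, θ j ≤ ∑ i ∈ firstIdx n (Fintype.card κ), spr hX i := by
  set μ : κ → ℂ := fun j => Complex.exp (θ j * Complex.I) with hμ
  have hμ1 : ∀ j, star (μ j) * μ j = 1 := fun j => by
    rw [← starRingEnd_apply, Complex.conj_mul', hμ]
    simp [Complex.norm_exp_ofReal_mul_I]
  have hUV' : Uᴴ * V = V * diagonal fun j => star (μ j) := by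
    have h1 : V = Uᴴ * V * diagonal μ := by
      rw [Matrix.mul_assoc, ← hUV, ← Matrix.mul_assoc, hU, Matrix.one_mul]
    conv_rhs => rw [h1]
    rw [Matrix.mul_assoc, diagonal_mul_diagonal]
    simp only [mul_comm (μ _), hμ1, diagonal_one, Matrix.mul_one]
  have hVU : Vᴴ * U = diagonal μ * Vᴴ := by
    have := congrArg conjTranspose hUV'
    simpa [conjTranspose_mul, diagonal_conjTranspose, Function.comp_def, Pi.star_def] using this
  -- `R` carries eigenvectors for `μ j` to eigenvectors for its conjugate, and `μ i` never equals
  -- the conjugate of `μ j`, all imaginary parts being positive.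
  have hVRV : Vᴴ * (R * V) = 0 := by
    have h1 : diagonal μ * (Vᴴ * (R * V)) = Vᴴ * (R * V) * diagonal fun j => star (μ j) := by
      calc _ = Vᴴ * U * (R * V) := by rw [hVU, Matrix.mul_assoc]
        _ = Vᴴ * (U * R) * V := by simp only [Matrix.mul_assoc]
        _ = Vᴴ * R * (Uᴴ * V) := by rw [hUR]; simp only [Matrix.mul_assoc]
        _ = _ := by rw [hUV']; simp only [Matrix.mul_assoc]
    ext i j
    have h2 := congrFun (congrFun h1 i) j
    rw [diagonal_mul, mul_diagonal, mul_comm, ← sub_eq_zero, ← mul_sub] at h2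
    refine (mul_eq_zero.1 h2).resolve_right fun h0 => ?_
    have h3 := congrArg Complex.im h0
    have him : ∀ j, 0 < (μ j).im := fun j => by
      simp only [hμ, Complex.exp_ofReal_mul_I_im]
      exact Real.sin_pos_of_pos_of_lt_pi (hθ j).1 (by linarith [(hθ j).2, Real.pi_pos])
    simp at h3
    linarith [him i, him j]
  have hRVRV : (R * V)ᴴ * (R * V) = 1 := by
    rw [conjTranspose_mul, hR.eq, Matrix.mul_assoc, ← Matrix.mul_assoc R, hRR, Matrix.one_mul, hV]
  have hRVV : (R * V)ᴴ * V = 0 := by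
    rw [conjTranspose_mul, hR.eq, Matrix.mul_assoc, hVRV]
  have hm := two_mul_card_le_of_orthonormal hV hRVRV hVRV
  refine ⟨hm, ?_⟩
  set c : ℝ := √2⁻¹ with hc
  have hcc : (c : ℂ) * c = 1 / 2 := by
    rw [← Complex.ofReal_mul, hc, Real.mul_self_sqrt (by norm_num)]; norm_num
  -- The normalized part of `V` fixed by `R`, so that the compression starts at `1`.
  set L : Matrix (Fin n) κ ℂ := (c : ℂ) • (V + R * V) with hL
  have hLh : Lᴴ = (c : ℂ) • (Vᴴ + (R * V)ᴴ) := by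
    rw [hL, conjTranspose_smul, conjTranspose_add]; simp
  have hLL : Lᴴ * L = 1 := by
    rw [hLh, hL, Matrix.smul_mul, Matrix.mul_smul, smul_smul, hcc, Matrix.add_mul, Matrix.mul_add,
      Matrix.mul_add, hV, hVRV, hRVV, hRVRV, add_zero, zero_add, ← two_smul ℂ, smul_smul]
    norm_num
  have hRL : R * L = L := by
    rw [hL, Matrix.mul_smul, Matrix.mul_add, ← Matrix.mul_assoc, hRR, Matrix.one_mul, add_comm]
  have hH0 : Lᴴ * R * L = 1 := by rw [Matrix.mul_assoc, hRL, hLL]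
  have hUL : U * R * Uᴴ * L = U * (U * L) := by
    rw [Matrix.mul_assoc U, ← hUR, Matrix.mul_assoc, Matrix.mul_assoc, hRL]
  have hURV : U * (R * V) = R * V * diagonal fun j => star (μ j) := by
    rw [← Matrix.mul_assoc, hUR, Matrix.mul_assoc, hUV', Matrix.mul_assoc]
  have hUUL : U * (U * L) = (c : ℂ) • (V * diagonal (fun j => μ j * μ j) +
      R * V * diagonal fun j => star (μ j) * star (μ j)) := by
    rw [hL, Matrix.mul_smul, Matrix.mul_smul, Matrix.mul_add, Matrix.mul_add, hUV, hURV,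
      ← Matrix.mul_assoc, hUV, ← Matrix.mul_assoc U, hURV, Matrix.mul_assoc, diagonal_mul_diagonal,
      Matrix.mul_assoc _ (diagonal _), diagonal_mul_diagonal]
  -- On `L` the moved reflection acts as `U ^ 2`, with phases `e^{±2iθ}` on the halves `V` and `R
  -- V`; their average is the cosine.
  have hH1 : Lᴴ * (U * R * Uᴴ) * L = diagonal fun j => ((Real.cos (2 * θ j) : ℝ) : ℂ) := by
    rw [Matrix.mul_assoc, hUL, hUUL, hLh, Matrix.smul_mul, Matrix.mul_smul, smul_smul, hcc,
      Matrix.add_mul, Matrix.mul_add, Matrix.mul_add, ← Matrix.mul_assoc, hV, ← Matrix.mul_assoc,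
      hVRV, ← Matrix.mul_assoc, hRVV, ← Matrix.mul_assoc, hRVRV, Matrix.one_mul, Matrix.one_mul,
      Matrix.zero_mul, Matrix.zero_mul, add_zero, zero_add, diagonal_add, ← diagonal_smul]
    congr 1
    funext j
    have h1 : μ j * μ j = Complex.exp ((2 * θ j : ℝ) * Complex.I) := by
      rw [hμ, ← Complex.exp_add]; congr 1; push_cast; ring
    rw [Pi.smul_apply, ← star_mul, h1, ← starRingEnd_apply, Complex.add_conj,
      Complex.exp_ofReal_mul_I_re, smul_eq_mul]
    push_cast
    ring
  refine le_of_forall_pos_le_add fun ε hε => ?_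
  obtain ⟨p, hp, hpa⟩ := exists_polynomial_arccos (η := ε / (Fintype.card κ + 1)) (by positivity)
  have hbd := norm_trace_aeval_sub_le hX hR hRR hLL hp hm
  have hdiag : ∀ h : κ → ℝ, (aeval (diagonal fun j => (h j : ℂ)) p).trace =
      ((∑ j, p.eval (h j) : ℝ) : ℂ) := fun h => by
    have := aeval_conj_diagonal (Submonoid.one_mem (Matrix.unitaryGroup κ ℂ)) h p
    simp only [conjTranspose_one, Matrix.one_mul, Matrix.mul_one] at this
    rw [this, trace_diagonal]; push_cast; rfl
  have h1 : (1 : Matrix κ κ ℂ) = diagonal fun _ => ((1 : ℝ) : ℂ) := by simp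
  rw [← hURX, hH1, hH0, hdiag, h1, hdiag, ← Complex.ofReal_sub, Complex.norm_real,
    Real.norm_eq_abs, abs_sub_comm, ← Finset.sum_sub_distrib] at hbd
  have h2 : ∑ j, (2 * θ j - ε / (Fintype.card κ + 1)) ≤
      ∑ j, (p.eval 1 - p.eval (Real.cos (2 * θ j))) := Finset.sum_le_sum fun j _ => by
    have := hpa _ ⟨Real.neg_one_le_cos (2 * θ j), Real.cos_le_one _⟩
    rwa [Real.arccos_cos (by linarith [(hθ j).1]) (by linarith [(hθ j).2])] at this
  rw [Finset.sum_sub_distrib, ← Finset.mul_sum, Finset.sum_const, nsmul_eq_mul,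
    Finset.card_univ] at h2
  have h3 : (Fintype.card κ : ℝ) * (ε / (Fintype.card κ + 1)) ≤ ε := by
    rw [mul_div_assoc', div_le_iff₀ (by positivity)]
    nlinarith
  linarith [le_abs_self (∑ j, (p.eval 1 - p.eval (Real.cos (2 * θ j))))]

end SpectralSpread

end

/-! ### The reflection of a direct rotation and the first majorization. -/

section

namespace SpectralSpread

open Matrix

open scoped ComplexOrder

/-- A reflection onto `S` commutes with every unitary that leaves `S` invariant. -/
theorem commute_of_invariant {n : ℕ} {S : Submodule ℂ (EuclideanSpace ℂ (Fin n))}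
    {R Y : Matrix (Fin n) (Fin n) ℂ} (hR : R.IsHermitian)
    (hS : ∀ x ∈ S, toEuclideanLin R x = x) (hS' : ∀ x, x + toEuclideanLin R x ∈ S)
    (hY : ∀ x ∈ S, toEuclideanLin Y x ∈ S) (hY' : ∀ x ∈ S, toEuclideanLin Yᴴ x ∈ S) :
    Y * R = R * Y := by
  have key : ∀ B : Matrix (Fin n) (Fin n) ℂ, (∀ x ∈ S, toEuclideanLin B x ∈ S) →
      R * (B * (1 + R)) = B * (1 + R) := fun B hB => by
    apply (toEuclideanLin (𝕜 := ℂ)).injective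
    refine LinearMap.ext fun x => ?_
    have h1 : toEuclideanLin (1 + R) x = x + toEuclideanLin R x := by simp
    simp only [toLpLin_mul_same, LinearMap.comp_apply, h1]
    exact hS _ (hB _ (hS' x))
  have h1 := key Y hY
  have h2 := congrArg conjTranspose (key Yᴴ hY')
  simp only [Matrix.mul_add, Matrix.mul_one] at h1
  simp only [conjTranspose_mul, conjTranspose_add, conjTranspose_conjTranspose, hR.eq,
    conjTranspose_one, Matrix.add_mul, Matrix.one_mul] at h2
  have h3 : (2 : ℂ) • (Y * R) = (2 : ℂ) • (R * Y) := by
    rw [two_smul, two_smul]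
    -- Subtracting the adjoint identity cancels `R Y R` and leaves `R Y - Y R` equal to its own
    -- negative.
    have h4 : (R * Y + R * (Y * R)) - (Y * R + R * Y * R) = (Y + Y * R) - (Y + R * Y) := by
      rw [h1, h2]
    rw [Matrix.mul_assoc] at h4
    have h5 : R * Y - Y * R = Y * R - R * Y := by
      rw [add_sub_add_right_eq_sub, add_sub_add_left_eq_sub] at h4
      exact h4
    rw [sub_eq_sub_iff_add_eq_add] at h5
    exact h5.symm
  exact smul_right_injective _ two_ne_zero h3

theorem posSemidef_fromBlocks_zero {ι κ : Type*} [Fintype ι] [Fintype κ] [DecidableEq ι]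
    [DecidableEq κ] {A : Matrix ι ι ℂ} {B : Matrix κ κ ℂ} (hA : A.PosSemidef) (hB : B.PosSemidef) :
    (fromBlocks A 0 0 B).PosSemidef := by
  have h := (hA.mul_mul_conjTranspose_same (fromRows (1 : Matrix ι ι ℂ) (0 : Matrix κ ι ℂ))).add
    (hB.mul_mul_conjTranspose_same (fromRows (0 : Matrix ι κ ℂ) (1 : Matrix κ κ ℂ)))
  convert h using 1
  ext (i | i) (j | j) <;>
    simp [fromRows_mul, conjTranspose_fromRows_eq_fromCols_conjTranspose]

/-- The reflection attached to a direct rotation. -/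
theorem IsDirectRotation.exists_reflection {n : ℕ}
    {S T : Submodule ℂ (EuclideanSpace ℂ (Fin n))} {U : Matrix (Fin n) (Fin n) ℂ}
    (hU : IsDirectRotation S T U) :
    (U + Uᴴ).PosSemidef ∧ ∃ R : Matrix (Fin n) (Fin n) ℂ, R.IsHermitian ∧ R * R = 1 ∧
      U * R = R * Uᴴ ∧ (∀ x ∈ S, toEuclideanLin R x = x) ∧
      ∀ x, x + toEuclideanLin R x ∈ S := by
  obtain ⟨-, -, k, m, h, W, C₀, C₁, S₀, hW, hspan, hC₀, hC₁, hWU⟩ := hU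
  set f : Fin k ⊕ Fin m ≃ Fin n := finSumFinEquiv.trans (finCongr h) with hf
  have hW1 : Wᴴ * W = 1 := mem_unitaryGroup_iff'.1 hW
  have hW2 : W * Wᴴ = 1 := mem_unitaryGroup_iff.1 hW
  set N := Wᴴ * U * W with hN
  have hUN : U = W * N * Wᴴ := by
    calc U = (W * Wᴴ) * U * (W * Wᴴ) := by rw [hW2, Matrix.one_mul, Matrix.mul_one]
      _ = _ := by rw [hN]; simp only [Matrix.mul_assoc]
  have hUN' : Uᴴ = W * Nᴴ * Wᴴ := by
    rw [hUN, conjTranspose_mul, conjTranspose_mul, conjTranspose_conjTranspose, Matrix.mul_assoc]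
  set D : Matrix (Fin n) (Fin n) ℂ := reindex f f (fromBlocks 1 0 0 (-1)) with hD
  have hDd : D = diagonal fun i => Sum.elim (fun _ => (1 : ℂ)) (fun _ => -1) (f.symm i) := by
    rw [hD, ← diagonal_one, ← diagonal_one, diagonal_neg, fromBlocks_diagonal, reindex_apply,
      submatrix_diagonal_equiv]
    rfl
  have hDD : D * D = 1 := by
    rw [hD, reindex_apply, submatrix_mul_equiv, fromBlocks_multiply]
    simp
  have hDh : Dᴴ = D := by
    rw [hD, conjTranspose_reindex, fromBlocks_conjTranspose]
    simp
  have hNh : Nᴴ = reindex f f (fromBlocks C₀ S₀ᴴ (-S₀) C₁) := by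
    rw [hWU, conjTranspose_reindex, fromBlocks_conjTranspose, hC₀.1.eq, hC₁.1.eq]
    simp
  have hND : N * D = D * Nᴴ := by
    rw [hNh, hWU, hD, reindex_apply, reindex_apply, reindex_apply, submatrix_mul_equiv,
      submatrix_mul_equiv, fromBlocks_multiply, fromBlocks_multiply]
    simp
  refine ⟨?_, W * D * Wᴴ, ?_, ?_, ?_, ?_, ?_⟩
  · have h1 : U + Uᴴ = W * (N + Nᴴ) * Wᴴ := by
      rw [hUN', Matrix.mul_add, Matrix.add_mul, ← hUN]
    have h2 : N + Nᴴ = (fromBlocks (C₀ + C₀) 0 0 (C₁ + C₁)).submatrix f.symm f.symm := by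
      rw [hNh, hWU, reindex_apply, reindex_apply, ← Pi.add_apply, ← Pi.add_apply,
        ← submatrix_add, fromBlocks_add]
      simp
    rw [h1, h2]
    exact PosSemidef.mul_mul_conjTranspose_same
      ((posSemidef_fromBlocks_zero (hC₀.add hC₀) (hC₁.add hC₁)).submatrix _) _
  · change (W * D * Wᴴ)ᴴ = _
    rw [conjTranspose_mul, conjTranspose_mul, conjTranspose_conjTranspose, hDh, Matrix.mul_assoc]
  · calc _ = W * (D * (Wᴴ * W) * D) * Wᴴ := by simp only [Matrix.mul_assoc]
      _ = 1 := by rw [hW1, Matrix.mul_one, hDD, Matrix.mul_one, hW2]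
  · calc _ = W * (N * (Wᴴ * W) * D) * Wᴴ := by
          nth_rw 1 [hUN]; simp only [Matrix.mul_assoc]
      _ = W * (D * (Wᴴ * W) * Nᴴ) * Wᴴ := by rw [hW1, Matrix.mul_one, Matrix.mul_one, hND]
      _ = _ := by rw [hUN']; simp only [Matrix.mul_assoc]
  · intro x hx
    rw [← hspan] at hx
    induction hx using Submodule.span_induction with
    | zero => simp
    | add x y _ _ hx hy => rw [map_add, hx, hy]
    | smul a x _ hx => rw [map_smul, hx]
    | mem x hx =>
      obtain ⟨j, rfl⟩ := hx
      have h1 : W * D * Wᴴ * W = W * D := by rw [Matrix.mul_assoc, hW1, Matrix.mul_one]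
      ext i
      have h2 := congrFun (congrFun h1 i) (f (Sum.inl j))
      rw [hDd, mul_diagonal, Equiv.symm_apply_apply, Sum.elim_inl, _root_.mul_one, ← hDd,
        mul_apply] at h2
      exact h2
  · intro x
    have h1 : x + toEuclideanLin (W * D * Wᴴ) x = toEuclideanLin (W * (1 + D) * Wᴴ) x := by
      rw [Matrix.mul_add, Matrix.mul_one, Matrix.add_mul, hW2]
      simp
    have h2 : toEuclideanLin (W * (1 + D) * Wᴴ) x =
        ∑ j, ((1 + D) j j * (toEuclideanLin Wᴴ x) j) •
          (WithLp.toLp 2 (W.col j) : EuclideanSpace ℂ (Fin n)) := by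
      have h1D : (1 + D) = diagonal fun j => (1 + D) j j := by
        conv_lhs => rw [hDd, ← diagonal_one, diagonal_add]
        congr 1
        funext j
        rw [hDd]; simp
      ext i
      rw [toLpLin_mul_same, LinearMap.comp_apply]
      generalize toEuclideanLin Wᴴ x = y
      rw [h1D]
      simp only [toLpLin_apply, mulVec, dotProduct, mul_diagonal, WithLp.ofLp_sum, Finset.sum_apply,
        WithLp.ofLp_smul, Pi.smul_apply, col_apply, diagonal_apply_eq, smul_eq_mul]
      exact Finset.sum_congr rfl fun j _ => by ring
    rw [h1, h2]
    refine Submodule.sum_mem _ fun j _ => ?_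
    obtain ⟨s, rfl⟩ := f.surjective j
    rcases s with s | s
    · refine Submodule.smul_mem _ _ ?_
      rw [← hspan]
      exact Submodule.subset_span ⟨s, rfl⟩
    · have : (1 + D) (f (Sum.inr s)) (f (Sum.inr s)) = 0 := by rw [hDd]; simp
      rw [this, zero_mul, zero_smul]
      exact Submodule.zero_mem _

theorem exp_I_smul_eq {n : ℕ} {Z Q : Matrix (Fin n) (Fin n) ℂ} {a : Fin n → ℝ}
    (hQ : Q ∈ Matrix.unitaryGroup (Fin n) ℂ)
    (hZ : Z = Q * diagonal (fun i => (a i : ℂ)) * Qᴴ) :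
    NormedSpace.exp (Complex.I • Z) =
      Q * diagonal (fun i => Complex.exp (a i * Complex.I)) * Qᴴ := by
  have hQ1 : Q * Qᴴ = 1 := mem_unitaryGroup_iff.1 hQ
  have hinv : Q⁻¹ = Qᴴ := inv_eq_right_inv hQ1
  have hu : IsUnit Q := IsUnit.of_mul_eq_one _ hQ1
  have h1 : Complex.I • Z = Q * diagonal (fun i => (a i * Complex.I : ℂ)) * Q⁻¹ := by
    rw [hZ, hinv, ← Matrix.smul_mul, ← Matrix.mul_smul, ← diagonal_smul]
    congr 3
    funext i
    simp [mul_comm]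
  rw [h1, Matrix.exp_conj _ _ hu, hinv, Matrix.exp_diagonal]
  congr 3
  funext i
  rw [Pi.coe_exp, Complex.exp_eq_exp_ℂ]

theorem abs_le_pi_div_two_of_cos_nonneg {x : ℝ} (hx : x ∈ Set.Icc (-Real.pi) Real.pi)
    (hc : 0 ≤ Real.cos x) : |x| ≤ Real.pi / 2 := by
  by_contra! h
  have h1 : |x| ≤ Real.pi := abs_le.2 hx
  have := Real.cos_neg_of_pi_div_two_lt_of_lt h (by linarith [Real.pi_pos])
  rw [Real.cos_abs] at this
  linarith

theorem sv_submajorized_half_spread (n : ℕ)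
    (S T : Submodule ℂ (EuclideanSpace ℂ (Fin n)))
    (X : Matrix (Fin n) (Fin n) ℂ) (hX : X.IsHermitian)
    (hXST : S.map (Matrix.toEuclideanLin (NormedSpace.exp (Complex.I • X))) = T)
    (U Z : Matrix (Fin n) (Fin n) ℂ) (hZ : Z.IsHermitian)
    (hUZ : U = NormedSpace.exp (Complex.I • Z))
    (hZpi : ∀ i, SpectralSpread.eigs hZ i ∈ Set.Icc (-Real.pi) Real.pi)
    (hU : SpectralSpread.IsDirectRotation S T U) :
    SpectralSpread.Submajorized (SpectralSpread.sv Z)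
        (fun i => (1 / 2 : ℝ) * |SpectralSpread.spr hX i|) := by
  obtain ⟨hpsd, R, hR, hRR, hUR, hRS, hRS'⟩ := hU.exists_reflection
  obtain ⟨hUu, hUST, -⟩ := hU
  have hU1 : Uᴴ * U = 1 := mem_unitaryGroup_iff'.1 hUu
  have hU2 : U * Uᴴ = 1 := mem_unitaryGroup_iff.1 hUu
  set E := NormedSpace.exp (Complex.I • X) with hE
  have hEh : Eᴴ = NormedSpace.exp (-(Complex.I • X)) := by
    rw [hE, ← Matrix.exp_conjTranspose, conjTranspose_smul, hX.eq]; simp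
  have hE2 : E * Eᴴ = 1 := by rw [hEh]; exact exp_mul_exp_neg _
  have hE1 : Eᴴ * E = 1 := mul_eq_one_comm.1 hE2
  -- If `A` and `B` carry `S` to the same subspace, `Aᴴ B` preserves `S`. Applied to `U` and `E` in
  -- both orders, it makes `Uᴴ E` commute with `R`, whence `U R Uᴴ = E R Eᴴ`.
  have hcomp : ∀ {A B : Matrix (Fin n) (Fin n) ℂ}, Aᴴ * A = 1 →
      S.map (toEuclideanLin A) = S.map (toEuclideanLin B) →
      ∀ x ∈ S, toEuclideanLin (Aᴴ * B) x ∈ S := fun {A B} hA hAB x hx => by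
    have h1 : toEuclideanLin B x ∈ S.map (toEuclideanLin A) := hAB ▸ Submodule.mem_map_of_mem hx
    obtain ⟨y, hy, hyx⟩ := Submodule.mem_map.1 h1
    rw [toLpLin_mul_same, LinearMap.comp_apply, ← hyx, ← LinearMap.comp_apply, ← toLpLin_mul_same,
      hA]
    simpa using hy
  have hcomm : Uᴴ * E * R = R * (Uᴴ * E) :=
    commute_of_invariant hR hRS hRS' (hcomp hU1 (hUST.trans hXST.symm)) (by
      rw [conjTranspose_mul, conjTranspose_conjTranspose]
      exact hcomp hE1 (hXST.trans hUST.symm))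
  have hURX : U * R * Uᴴ = E * R * NormedSpace.exp (-(Complex.I • X)) := by
    rw [← hEh]
    calc _ = U * (R * (Uᴴ * E)) * Eᴴ := by
          rw [← Matrix.mul_assoc R, ← Matrix.mul_assoc U, Matrix.mul_assoc _ E, hE2, Matrix.mul_one,
            Matrix.mul_assoc]
      _ = (U * Uᴴ) * E * R * Eᴴ := by rw [← hcomm]; simp only [Matrix.mul_assoc]
      _ = _ := by rw [hU2, Matrix.one_mul]
  obtain ⟨Q, hQ, hZQ⟩ := exists_unitary_eigs hZ
  have hQ1 : Qᴴ * Q = 1 := mem_unitaryGroup_iff'.1 hQ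
  set a := eigs hZ with ha
  have hUQ : U = Q * diagonal (fun i => Complex.exp (a i * Complex.I)) * Qᴴ := by
    rw [hUZ]; exact exp_I_smul_eq hQ hZQ
  have hUQ1 : U * Q = Q * diagonal fun i => Complex.exp (a i * Complex.I) := by
    rw [hUQ, Matrix.mul_assoc, hQ1, Matrix.mul_one]
  have hUQ2 : Uᴴ * Q = Q * diagonal fun i => Complex.exp ((-a i : ℝ) * Complex.I) := by
    rw [hUQ, conjTranspose_mul, conjTranspose_mul, conjTranspose_conjTranspose,
      diagonal_conjTranspose, Matrix.mul_assoc, Matrix.mul_assoc, hQ1, Matrix.mul_one]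
    congr 2
    funext i
    rw [Pi.star_apply, ← starRingEnd_apply, ← Complex.exp_conj]
    simp
  have hcos : ∀ i, 0 ≤ Real.cos (a i) := fun i => by
    have h1 : Qᴴ * (U + Uᴴ) * Q = diagonal fun i => ((2 * Real.cos (a i) : ℝ) : ℂ) := by
      rw [Matrix.mul_assoc, Matrix.add_mul, hUQ1, hUQ2, ← Matrix.mul_add, ← Matrix.mul_assoc, hQ1,
        Matrix.one_mul, diagonal_add]
      congr 1
      funext i
      push_cast
      rw [Complex.two_cos]
    have h2 := hpsd.conjTranspose_mul_mul_same Q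
    rw [h1, posSemidef_diagonal_iff] at h2
    have h3 := h2 i
    rw [Complex.zero_le_real] at h3
    linarith
  have hab : ∀ i, |a i| ≤ Real.pi / 2 := fun i =>
    abs_le_pi_div_two_of_cos_nonneg (hZpi i) (hcos i)
  have hsub : ∀ A : Finset (Fin n), (Q.submatrix id ((↑) : A → Fin n))ᴴ *
      Q.submatrix id ((↑) : A → Fin n) = 1 := fun A => by
    rw [conjTranspose_submatrix, ← submatrix_mul _ _ _ _ _ Function.bijective_id, hQ1,
      submatrix_one _ Subtype.val_injective]
  have hsubd : ∀ (A : Finset (Fin n)) (B : Matrix (Fin n) (Fin n) ℂ) (d : Fin n → ℂ),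
      B * Q = Q * diagonal d → B * Q.submatrix id ((↑) : A → Fin n) =
        Q.submatrix id ((↑) : A → Fin n) * diagonal fun j : A => d j := fun A B d h => by
    ext i j
    have h1 := congrFun (congrFun h i) j
    rw [mul_diagonal, mul_apply] at h1
    rw [mul_diagonal, mul_apply]
    exact h1
  obtain ⟨σ, hσ⟩ := exists_perm_sv hZ
  rw [show sv Z = fun i => |a (σ i)| from funext hσ]
  refine abs_submajorized_spread σ (fun A hA => ?_) fun A hA => ?_
  · have hV := hsubd A U _ hUQ1
    have h := two_mul_sum_angles_le hX hR hRR hU1 hUR hURX (hsub A) (θ := fun j : A => a j)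
      (fun j => ⟨hA j j.2, (le_abs_self _).trans (hab j)⟩) hV
    rw [Fintype.card_coe, Finset.sum_coe_sort A a] at h
    exact h
  -- For negative angles `R` turns the eigenvectors of `U` into eigenvectors with the opposite,
  -- positive, angles.
  · have hV := hsubd A Uᴴ _ hUQ2
    have h := two_mul_sum_angles_le hX hR hRR hU1 hUR hURX
      (V := R * Q.submatrix id ((↑) : A → Fin n)) (by
        rw [conjTranspose_mul, hR.eq, Matrix.mul_assoc, ← Matrix.mul_assoc R, hRR, Matrix.one_mul,
          hsub]) (θ := fun j : A => -a j)
      (fun j => ⟨neg_pos.2 (hA j j.2), (neg_le_abs _).trans (hab j)⟩) (by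
        rw [← Matrix.mul_assoc, hUR, Matrix.mul_assoc, hV, Matrix.mul_assoc])
    rw [Fintype.card_coe, Finset.sum_coe_sort A fun i => -a i] at h
    exact h

end SpectralSpread

end

theorem corollary2p11 (n k : ℕ)
    (S T : Submodule ℂ (EuclideanSpace ℂ (Fin n)))
    (hS : Module.finrank ℂ S = k) (hT : Module.finrank ℂ T = k)
    (X : Matrix (Fin n) (Fin n) ℂ) (hX : X.IsHermitian)
    (hXST : S.map (Matrix.toEuclideanLin (NormedSpace.exp (Complex.I • X))) = T)
    (U Z : Matrix (Fin n) (Fin n) ℂ) (hZ : Z.IsHermitian)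
    (hUZ : U = NormedSpace.exp (Complex.I • Z))
    (hZpi : ∀ i, SpectralSpread.eigs hZ i ∈ Set.Icc (-Real.pi) Real.pi)
    (hU : SpectralSpread.IsDirectRotation S T U) :
    SpectralSpread.Submajorized (SpectralSpread.sv Z)
        (fun i => (1 / 2 : ℝ) * |SpectralSpread.spr hX i|) ∧
      SpectralSpread.Submajorized (fun i => (1 / 2 : ℝ) * |SpectralSpread.spr hX i|)
        (SpectralSpread.sv X) := by
  refine ⟨SpectralSpread.sv_submajorized_half_spread n S T X hX hXST U Z hZ hUZ hZpi hU, ?_⟩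
  obtain ⟨σ, hσ⟩ := SpectralSpread.exists_perm_sv hX
  rw [show SpectralSpread.sv X = fun i => |SpectralSpread.eigs hX (σ i)| from funext hσ]
  exact SpectralSpread.submajorized_abs_spread (SpectralSpread.eigs hX) σ
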